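/- Let $f:\mathbb R^n\to\mathbb R^n$ and $g:\mathbb R^n\to\mathbb R^{n\times m}$ be locally Lipschitz, let the state space $\mathcal X\subset\mathbb R^n$ be compact, let $\phi:\mathcal X\to\mathbb R^p$ be a function, let $q\in\mathbb R^p$, and put $\mathcal E(q)=\{x\in\mathcal X:\phi(x)=q\}$. Let $V$ be a real-valued function, continuously differentiable on a neighbourhood of $\mathcal X$, and let $\hat u:\mathcal X\to\mathbb R^m$ be continuous, such that 1. $V(x)>0$ for $x\in\mathcal X\setminus\mathcal E(q)$ and $V(x)=0$ for $x\in\mathcal E(q)$; 2. $\dot V(x):=\nabla V(x)^\top\big(f(x)+g(x)\hat u(x)\big)<0$ for all $x\in\mathcal X\setminus\mathcal E(q)$; 3. $f(x)+g(x)\hat u(x)=0$ for all $x\in\mathcal E(q)$. A *trajectory* on an interval $J\subset[0,\infty)$ containing $0$ is a solution $x:J\to\mathcal X$ of the closed-loop system $\dot x=f(x)+g(x)\hat u(x)$ on $J$; it is *complete* if $J=[0,\infty)$. The *$\varepsilon$-neighbourhood* of $\mathcal E(q)$ is the set of points at distance less than $\varepsilon$ from some point of $\mathcal E(q)$. Then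 $\mathcal E(q)$ is asymptotically stable for the closed-loop system on $\mathcal X$, that is: (a) (stability) for every $\varepsilon>0$ there is $\delta>0$ such that every trajectory on an interval $[0,T]$, $T\ge 0$, that starts in the $\delta$-neighbourhood of $\mathcal E(q)$ stays in the $\varepsilon$-neighbourhood of $\mathcal E(q)$ on $[0,T]$; (b) (attractivity) for every complete trajectory $x$, from any initial state in $\mathcal X$, and every $\varepsilon>0$, $x(t)$ lies in the $\varepsilon$-neighbourhood of $\mathcal E(q)$ for all sufficiently large $t$. Moreover, if for some $\rho>0$ every point of $\mathcal X$ in the $\rho$-neighbourhood of $\mathcal E(q)$ is the initial state of a trajectory on some interval $[0,\tau]$ with $\tau>0$, then there is $r>0$ such that every trajectory on an interval $[0,T]$, $T\ge0$, that starts in the $r$-neighbourhood of $\mathcal E(q)$ extends to a complete trajectory. -/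

import Mathlib

namespace ClosedLoop

variable {n m p : ℕ}

/-- The right-hand side `f x + g x u` of the control-affine system `ẋ = f x + g x u` in closed loop
with the state feedback `u`. The `n × m` matrix `g x` is given as a linear map `ℝᵐ → ℝⁿ`. -/
def field (f : EuclideanSpace ℝ (Fin n) → EuclideanSpace ℝ (Fin n))
    (g : EuclideanSpace ℝ (Fin n) → EuclideanSpace ℝ (Fin m) →L[ℝ] EuclideanSpace ℝ (Fin n))
    (u : EuclideanSpace ℝ (Fin n) → EuclideanSpace ℝ (Fin m)) :
    EuclideanSpace ℝ (Fin n) → EuclideanSpace ℝ (Fin n) :=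
  fun x => f x + g x (u x)

/-- The goal set `{x ∈ X : φ x = q}`. -/
def goalSet (X : Set (EuclideanSpace ℝ (Fin n)))
    (φ : EuclideanSpace ℝ (Fin n) → EuclideanSpace ℝ (Fin p)) (q : EuclideanSpace ℝ (Fin p)) :
    Set (EuclideanSpace ℝ (Fin n)) :=
  {x | x ∈ X ∧ φ x = q}

/-- The Lie derivative `∇V(x)ᵀ F(x)`, which is the time derivative of `V` along the solutions of
`ẋ = F x`. -/
noncomputable def lieDeriv (F : EuclideanSpace ℝ (Fin n) → EuclideanSpace ℝ (Fin n))
    (V : EuclideanSpace ℝ (Fin n) → ℝ) (x : EuclideanSpace ℝ (Fin n)) : ℝ :=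
  inner ℝ (gradient V x) (F x)

/-- `x` is a trajectory of `ẋ = F x` on the time interval `J` in the state space `X`: it solves the
equation on `J` (with one-sided derivatives at end points of `J`) and all its values are states. -/
def IsTrajectoryOn (X : Set (EuclideanSpace ℝ (Fin n)))
    (F : EuclideanSpace ℝ (Fin n) → EuclideanSpace ℝ (Fin n)) (J : Set ℝ)
    (x : ℝ → EuclideanSpace ℝ (Fin n)) : Prop :=
  IsIntegralCurveOn x (fun _ => F) J ∧ Set.MapsTo x J X

/-- Lyapunov stability of the set `E` in the state space `X`: trajectories, complete or not, that
start close to `E` stay close to `E` for as long as they exist. -/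
def IsLyapunovStable (X : Set (EuclideanSpace ℝ (Fin n)))
    (F : EuclideanSpace ℝ (Fin n) → EuclideanSpace ℝ (Fin n))
    (E : Set (EuclideanSpace ℝ (Fin n))) : Prop :=
  ∀ ε > 0, ∃ δ > 0, ∀ T : ℝ, 0 ≤ T → ∀ x, IsTrajectoryOn X F (Set.Icc 0 T) x →
    x 0 ∈ Metric.thickening δ E → ∀ t ∈ Set.Icc 0 T, x t ∈ Metric.thickening ε E

/-- Attractivity of the set `E`, with the whole state space `X` as region of attraction: every
complete trajectory in `X` converges to `E`. -/
def IsAttractive (X : Set (EuclideanSpace ℝ (Fin n)))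
    (F : EuclideanSpace ℝ (Fin n) → EuclideanSpace ℝ (Fin n))
    (E : Set (EuclideanSpace ℝ (Fin n))) : Prop :=
  ∀ x, IsTrajectoryOn X F (Set.Ici 0) x →
    ∀ ε > 0, ∀ᶠ t in Filter.atTop, x t ∈ Metric.thickening ε E

/-- Asymptotic stability of the set `E` for `ẋ = F x` on the state space `X`. -/
def IsAsymptoticallyStable (X : Set (EuclideanSpace ℝ (Fin n)))
    (F : EuclideanSpace ℝ (Fin n) → EuclideanSpace ℝ (Fin n))
    (E : Set (EuclideanSpace ℝ (Fin n))) : Prop :=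
  IsLyapunovStable X F E ∧ IsAttractive X F E

/-- Near `E`, the equation `ẋ = F x` has local solutions in `X`: every state close to `E` is the
initial state of a trajectory in `X` on some time interval of positive length. -/
def IsLocallySolvableNear (X : Set (EuclideanSpace ℝ (Fin n)))
    (F : EuclideanSpace ℝ (Fin n) → EuclideanSpace ℝ (Fin n))
    (E : Set (EuclideanSpace ℝ (Fin n))) : Prop :=
  ∃ ρ > 0, ∀ z ∈ X ∩ Metric.thickening ρ E, ∃ τ > 0, ∃ x,
    IsTrajectoryOn X F (Set.Icc 0 τ) x ∧ x 0 = z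

/-- Near `E`, trajectories exist for all times: every trajectory on an interval `[0, T]` that starts
in `X` close to `E` extends to one on `[0, ∞)`. For `T = 0` this says that every state close to `E`
is the initial state of a complete trajectory. -/
def IsForwardCompleteNear (X : Set (EuclideanSpace ℝ (Fin n)))
    (F : EuclideanSpace ℝ (Fin n) → EuclideanSpace ℝ (Fin n))
    (E : Set (EuclideanSpace ℝ (Fin n))) : Prop :=
  ∃ r > 0, ∀ T : ℝ, 0 ≤ T → ∀ x, IsTrajectoryOn X F (Set.Icc 0 T) x →
    x 0 ∈ Metric.thickening r E →
    ∃ y, IsTrajectoryOn X F (Set.Ici 0) y ∧ Set.EqOn y x (Set.Icc 0 T)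

end ClosedLoop

/-!
Write `F` for the closed-loop field and `E` for the goal set. Along a trajectory the derivative of
`V` is the Lie derivative of `V` along `F`, which is negative off `E` by hypothesis and zero on `E`
because `F` vanishes there; hence `V` does not increase along trajectories. As `X` is compact and
`V` is continuous and positive on `X` off `E`, the values of `V` on `X` outside the
`ε`-neighbourhood of `E` are bounded below by a positive constant, while `V` is smaller than that
constant close to `E` (`exists_sublevel_trap`). This gives stability.

For attractivity, a trajectory that enters the `δ`-neighbourhood belonging to `ε` remains within
`ε` from then on. A complete trajectory that never enters it stays in the compact set of states at
distance at least `δ` from `E`, where the Lie derivative is bounded away from zero; then `V` would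
decrease below zero (`isAttractive_of_lieDeriv_neg`).

Forward completeness is a continuation argument (`isForwardCompleteNear_of_isLyapunovStable`).
The field is only continuous on `X`, so trajectories need not be unique, and Zorn's lemma replaces
the usual maximal solution. A trajectory on `[0, S)` is Lipschitz, because `F` is bounded on the
compact set `X`, and so it has a limit at `S`, which lies in `X`, and extends to `[0, S]`
(`IsTrajectoryOn.exists_extend_Icc`). Stability keeps the end point in the region of local
solvability, so that the trajectory continues beyond `S` (`IsTrajectoryOn.exists_concat`).
-/

namespace ClosedLoop

open Set Filter Topology Metric

section Lyapunov

/-! ### Lyapunov functions on a compact state space -/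

variable {n : ℕ} {X E : Set (EuclideanSpace ℝ (Fin n))}
  {F : EuclideanSpace ℝ (Fin n) → EuclideanSpace ℝ (Fin n)} {V : EuclideanSpace ℝ (Fin n) → ℝ}

theorem lieDeriv_eq_fderiv (x : EuclideanSpace ℝ (Fin n)) :
    lieDeriv F V x = fderiv ℝ V x (F x) := by
  rw [lieDeriv, ← toDual_gradient, InnerProductSpace.toDual_apply_apply]

theorem continuousOn_lieDeriv (hV : ∀ x ∈ X, ContDiffAt ℝ 1 V x) (hF : ContinuousOn F X) :
    ContinuousOn (lieDeriv F V) X := by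
  have h : ContinuousOn (fun x => fderiv ℝ V x (F x)) X :=
    ContinuousOn.clm_apply
      (fun x hx => ((hV x hx).continuousAt_fderiv one_ne_zero).continuousWithinAt) hF
  exact h.congr fun x _ => lieDeriv_eq_fderiv x

/-- If the Lie derivative of `V` is at most `-c` along a trajectory, then `V` decreases at least at
the rate `c`. -/
theorem IsTrajectoryOn.antitoneOn_add_mul {J : Set ℝ} (hJ : Convex ℝ J)
    {x : ℝ → EuclideanSpace ℝ (Fin n)} (hx : IsTrajectoryOn X F J x)
    (hV : ∀ x ∈ X, ContDiffAt ℝ 1 V x) {c : ℝ} (hc : ∀ t ∈ J, lieDeriv F V (x t) ≤ -c) :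
    AntitoneOn (fun t => V (x t) + c * t) J := by
  have hd : ∀ t ∈ J,
      HasDerivWithinAt (fun t => V (x t) + c * t) (lieDeriv F V (x t) + c) J t := by
    intro t ht
    rw [lieDeriv_eq_fderiv]
    have h1 := ((hV _ (hx.2 ht)).differentiableAt one_ne_zero).hasFDerivAt.comp_hasDerivWithinAt
      t (hx.1 t ht)
    have h2 : HasDerivWithinAt (fun t : ℝ => c * t) c J t := by
      simpa using (hasDerivWithinAt_id t J).const_mul c
    exact h1.add h2
  refine antitoneOn_of_hasDerivWithinAt_nonpos hJ (fun t ht => (hd t ht).continuousWithinAt)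
    (fun t ht => (hd t (interior_subset ht)).mono interior_subset) fun t ht => ?_
  linarith [hc t (interior_subset ht)]

theorem IsTrajectoryOn.antitoneOn {J : Set ℝ} (hJ : Convex ℝ J)
    {x : ℝ → EuclideanSpace ℝ (Fin n)} (hx : IsTrajectoryOn X F J x)
    (hV : ∀ x ∈ X, ContDiffAt ℝ 1 V x) (hd : ∀ x ∈ X, lieDeriv F V x ≤ 0) :
    AntitoneOn (fun t => V (x t)) J := by
  simpa using hx.antitoneOn_add_mul hJ hV (c := 0) fun t ht => by simpa using hd _ (hx.2 ht)

/-- A state at which `V` is at most as large as at some state `δ`-close to `E` is itself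
`ε`-close to `E`. -/
theorem exists_sublevel_trap (hX : IsCompact X) (hV : ContinuousOn V X)
    (hVpos : ∀ x ∈ X, x ∉ E → 0 < V x) (hVzero : ∀ x ∈ E, V x = 0) (hEX : E ⊆ X)
    {ε : ℝ} (hε : 0 < ε) :
    ∃ δ > 0, ∀ y ∈ X, y ∈ thickening δ E → ∀ z ∈ X, V z ≤ V y → z ∈ thickening ε E := by
  have hEeq : E = X ∩ V ⁻¹' Iic 0 := by
    ext x
    refine ⟨fun h => ⟨hEX h, (hVzero x h).le⟩, fun h => ?_⟩
    by_contra hx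
    exact absurd (hVpos x h.1 hx) (not_lt.2 h.2)
  have hEc : IsCompact E := by
    rw [hEeq]
    exact hX.of_isClosed_subset (hV.preimage_isClosed_of_isClosed hX.isClosed isClosed_Iic)
      inter_subset_left
  have hK : IsCompact (X \ thickening ε E) := hX.diff isOpen_thickening
  -- `a` is a positive lower bound of `V` far from `E`.
  obtain ⟨a, ha, haK⟩ : ∃ a > 0, ∀ z ∈ X \ thickening ε E, a ≤ V z := by
    rcases (X \ thickening ε E).eq_empty_or_nonempty with h | h
    · exact ⟨1, one_pos, by simp [h]⟩
    · obtain ⟨z, hz, hmin⟩ := hK.exists_isMinOn h (hV.mono sdiff_subset)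
      exact ⟨V z, hVpos z hz.1 fun h => hz.2 (self_subset_thickening hε E h),
        fun w hw => hmin hw⟩
  have hC : IsClosed (X ∩ V ⁻¹' Ici a) :=
    hV.preimage_isClosed_of_isClosed hX.isClosed isClosed_Ici
  obtain ⟨δ, hδ, hsub⟩ := hEc.exists_thickening_subset_open hC.isOpen_compl
    fun x hx h => by
      have h2 : a ≤ V x := h.2
      rw [hVzero x hx] at h2
      exact absurd ha (not_lt.2 h2)
  refine ⟨δ, hδ, fun y hy hyδ z hz hzy => ?_⟩
  by_contra hzε
  exact hsub hyδ ⟨hy, (haK z ⟨hz, hzε⟩).trans hzy⟩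

theorem isLyapunovStable_of_lieDeriv_nonpos (hX : IsCompact X) (hEX : E ⊆ X)
    (hV : ∀ x ∈ X, ContDiffAt ℝ 1 V x)
    (hVpos : ∀ x ∈ X, x ∉ E → 0 < V x) (hVzero : ∀ x ∈ E, V x = 0)
    (hd : ∀ x ∈ X, lieDeriv F V x ≤ 0) : IsLyapunovStable X F E := by
  intro ε hε
  obtain ⟨δ, hδ, h⟩ := exists_sublevel_trap hX
    (fun x hx => (hV x hx).continuousAt.continuousWithinAt) hVpos hVzero hEX hε
  refine ⟨δ, hδ, fun T hT x hx hx0 t ht => ?_⟩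
  have h0 : (0 : ℝ) ∈ Icc 0 T := ⟨le_rfl, hT⟩
  exact h _ (hx.2 h0) hx0 _ (hx.2 ht) (hx.antitoneOn (convex_Icc 0 T) hV hd h0 ht ht.1)

theorem isAttractive_of_lieDeriv_neg (hX : IsCompact X) (hEX : E ⊆ X) (hF : ContinuousOn F X)
    (hV : ∀ x ∈ X, ContDiffAt ℝ 1 V x)
    (hVpos : ∀ x ∈ X, x ∉ E → 0 < V x) (hVzero : ∀ x ∈ E, V x = 0)
    (hd : ∀ x ∈ X, lieDeriv F V x ≤ 0) (hdneg : ∀ x ∈ X, x ∉ E → lieDeriv F V x < 0) :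
    IsAttractive X F E := by
  intro x hx ε hε
  obtain ⟨δ, hδ, h⟩ := exists_sublevel_trap hX
    (fun x hx => (hV x hx).continuousAt.continuousWithinAt) hVpos hVzero hEX hε
  by_cases hent : ∃ s, 0 ≤ s ∧ x s ∈ thickening δ E
  · obtain ⟨s, hs, hxs⟩ := hent
    filter_upwards [eventually_ge_atTop s] with t hst
    have ht : (0 : ℝ) ≤ t := hs.trans hst
    exact h _ (hx.2 hs) hxs _ (hx.2 ht) (hx.antitoneOn (convex_Ici 0) hV hd hs ht hst)
  · push Not at hent
    exfalso
    have hK : IsCompact (X \ thickening δ E) := hX.diff isOpen_thickening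
    have h0 : (0 : ℝ) ∈ Ici (0 : ℝ) := self_mem_Ici
    obtain ⟨z, hz, hmax⟩ := hK.exists_isMaxOn ⟨x 0, hx.2 h0, hent 0 le_rfl⟩
      ((continuousOn_lieDeriv hV hF).mono sdiff_subset)
    have hneg : lieDeriv F V z < 0 :=
      hdneg z hz.1 fun h => hz.2 (self_subset_thickening hδ E h)
    have hanti := hx.antitoneOn_add_mul (convex_Ici 0) hV (c := -lieDeriv F V z)
      fun t ht => by
        rw [neg_neg]
        exact hmax ⟨hx.2 ht, hent t ht⟩
    have hVnn : ∀ y ∈ X, 0 ≤ V y := fun y hy => by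
      by_cases hyE : y ∈ E
      · exact (hVzero y hyE).ge
      · exact (hVpos y hy hyE).le
    -- At time `t`, the rate `-lieDeriv F V z` has used up more than the initial value of `V`.
    set t : ℝ := (V (x 0) + 1) / (-lieDeriv F V z) with ht_def
    have ht : 0 ≤ t := div_nonneg (by linarith [hVnn _ (hx.2 h0)]) (by linarith)
    have h1 : V (x t) + -lieDeriv F V z * t ≤ V (x 0) + -lieDeriv F V z * 0 := hanti h0 ht ht
    rw [ht_def, mul_div_cancel₀ _ (by linarith : -lieDeriv F V z ≠ 0), ← ht_def] at h1
    linarith [hVnn _ (hx.2 ht)]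

end Lyapunov

section Continuation

/-! ### Continuation of trajectories -/

variable {n : ℕ} {X E : Set (EuclideanSpace ℝ (Fin n))}
  {F : EuclideanSpace ℝ (Fin n) → EuclideanSpace ℝ (Fin n)}

theorem IsTrajectoryOn.congr {J : Set ℝ} {x y : ℝ → EuclideanSpace ℝ (Fin n)}
    (hx : IsTrajectoryOn X F J x) (h : EqOn y x J) : IsTrajectoryOn X F J y := by
  refine ⟨fun t ht => ?_, fun t ht => ?_⟩
  · have := (hx.1 t ht).congr h (h ht)
    simpa only [h ht] using this
  · rw [h ht]
    exact hx.2 ht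

/-- Being a trajectory on a set of nonnegative times can be checked on initial segments. -/
theorem isTrajectoryOn_of_forall_Icc {J : Set ℝ} (hJ : J ⊆ Ici 0)
    {y : ℝ → EuclideanSpace ℝ (Fin n)}
    (h : ∀ t ∈ J, ∃ s, t < s ∧ IsTrajectoryOn X F (Icc 0 s) y) : IsTrajectoryOn X F J y := by
  refine ⟨fun t ht => ?_, fun t ht => ?_⟩ <;> obtain ⟨s, hts, hs⟩ := h t ht
  · refine (hs.1 t ⟨hJ ht, hts.le⟩).mono_of_mem_nhdsWithin ?_
    filter_upwards [self_mem_nhdsWithin, nhdsWithin_le_nhds (Iio_mem_nhds hts)] with r hr hrs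
    exact ⟨hJ hr, le_of_lt hrs⟩
  · exact hs.2 ⟨hJ ht, hts.le⟩

/-- A trajectory on `[0, S)` in a compact state space extends to the end point `S`. -/
theorem IsTrajectoryOn.exists_extend_Icc (hX : IsCompact X) (hF : ContinuousOn F X) {S : ℝ}
    (hS : 0 < S) {y : ℝ → EuclideanSpace ℝ (Fin n)} (hy : IsTrajectoryOn X F (Ico 0 S) y) :
    ∃ z, IsTrajectoryOn X F (Icc 0 S) z ∧ EqOn z y (Ico 0 S) := by
  obtain ⟨C, hC⟩ := hX.exists_bound_of_continuousOn hF
  have hlip : LipschitzOnWith C.toNNReal y (Ico 0 S) :=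
    (convex_Ico 0 S).lipschitzOnWith_of_nnnorm_hasDerivWithin_le (fun t ht => hy.1 t ht)
      fun t ht => by
        rw [← NNReal.coe_le_coe, coe_nnnorm]
        exact (hC _ (hy.2 ht)).trans (Real.le_coe_toNNReal C)
  obtain ⟨z, hz, hyz⟩ := hlip.extend_finite_dimension
  have hzt : IsTrajectoryOn X F (Ico 0 S) z := hy.congr hyz.symm
  have hzX : MapsTo z (Icc 0 S) X := by
    rw [← closure_Ico hS.ne]
    exact hX.isClosed.closure_eq ▸ hzt.2.closure hz.continuous
  have hSS : S ∈ Icc 0 S := ⟨hS.le, le_rfl⟩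
  have hd : ∀ t ∈ Ioo 0 S, HasDerivAt z (F (z t)) t := fun t ht =>
    (hzt.1 t ⟨ht.1.le, ht.2⟩).hasDerivAt (Ico_mem_nhds ht.1 ht.2)
  have hIoo : Ioo 0 S ∈ 𝓝[<] S := Ioo_mem_nhdsLT hS
  refine ⟨z, ⟨fun t ht => ?_, hzX⟩, hyz.symm⟩
  rcases ht.2.lt_or_eq with htS | rfl
  · refine (hzt.1 t ⟨ht.1, htS⟩).mono_of_mem_nhdsWithin ?_
    filter_upwards [self_mem_nhdsWithin, nhdsWithin_le_nhds (Iio_mem_nhds htS)] with r hr hrs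
    exact ⟨hr.1, hrs⟩
  · -- At `S` the derivatives `F (z t)` converge to `F (z S)`, by continuity of `F` on `X`.
    refine (hasDerivWithinAt_Iic_of_tendsto_deriv (s := Ioo 0 t)
      (fun r hr => (hd r hr).differentiableAt.differentiableWithinAt)
      hz.continuous.continuousWithinAt hIoo ?_).mono Icc_subset_Iic_self
    have hFz : Tendsto (fun r => F (z r)) (𝓝[Ioo 0 t] t) (𝓝 (F (z t))) :=
      ((hF.comp hz.continuous.continuousOn hzX) t hSS).mono Ioo_subset_Icc_self
    rw [nhdsWithin_Ioo_eq_nhdsLT hS] at hFz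
    refine hFz.congr' ?_
    filter_upwards [hIoo] with r hr
    exact (hd r hr).deriv.symm

/-- Concatenation of a trajectory with one that starts at its end point. -/
theorem IsTrajectoryOn.exists_concat {S τ : ℝ} (hS : 0 ≤ S)
    {z w : ℝ → EuclideanSpace ℝ (Fin n)} (hz : IsTrajectoryOn X F (Icc 0 S) z)
    (hw : IsTrajectoryOn X F (Icc 0 τ) w) (hzw : w 0 = z S) :
    ∃ y, IsTrajectoryOn X F (Icc 0 (S + τ)) y ∧ EqOn y z (Icc 0 S) := by
  classical
  set y : ℝ → EuclideanSpace ℝ (Fin n) := fun t => if t ≤ S then z t else w (t - S) with hy_def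
  have hy1 : EqOn y z (Icc 0 S) := fun t ht => if_pos ht.2
  have hy2 : EqOn y (fun t => w (t - S)) (Icc S (S + τ)) := fun t ht => by
    rcases ht.1.eq_or_lt with rfl | h
    · simp [hy_def, hzw]
    · exact if_neg (not_le.2 h)
  have ht1 : IsTrajectoryOn X F (Icc 0 S) y := hz.congr hy1
  have ht2 : IsTrajectoryOn X F (Icc S (S + τ)) y := by
    have hmaps : MapsTo (fun t => t - S) (Icc S (S + τ)) (Icc 0 τ) := fun t ht =>
      ⟨sub_nonneg.2 ht.1, by linarith [ht.2]⟩
    refine IsTrajectoryOn.congr (x := fun t => w (t - S)) ⟨fun t ht => ?_, hw.2.comp hmaps⟩ hy2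
    simpa [Function.comp_def] using
      (hw.1 _ (hmaps ht)).scomp t ((hasDerivWithinAt_id t _).sub_const S) hmaps
  refine ⟨y, ⟨fun t ht => ?_, fun t ht => ?_⟩, hy1⟩
  · rcases lt_trichotomy t S with h | rfl | h
    · refine (ht1.1 t ⟨ht.1, h.le⟩).mono_of_mem_nhdsWithin ?_
      filter_upwards [self_mem_nhdsWithin, nhdsWithin_le_nhds (Iio_mem_nhds h)] with r hr hrs
      exact ⟨hr.1, le_of_lt hrs⟩
    · rw [← Icc_union_Icc_eq_Icc hS ht.2]
      exact (ht1.1 t ⟨hS, le_rfl⟩).union (ht2.1 t ⟨le_rfl, ht.2⟩)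
    · refine (ht2.1 t ⟨h.le, ht.2⟩).mono_of_mem_nhdsWithin ?_
      filter_upwards [self_mem_nhdsWithin, nhdsWithin_le_nhds (Ioi_mem_nhds h)] with r hr hrs
      exact ⟨le_of_lt hrs, hr.2⟩
  · rcases le_total t S with h | h
    · exact ht1.2 ⟨ht.1, h⟩
    · exact ht2.2 ⟨h, ht.2⟩

/-- A continuation of `x` beyond `[0, T]`: an end time and a trajectory up to that time which agrees
with `x` on `[0, T]`. -/
structure Continuation (X : Set (EuclideanSpace ℝ (Fin n)))
    (F : EuclideanSpace ℝ (Fin n) → EuclideanSpace ℝ (Fin n)) (T : ℝ)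
    (x : ℝ → EuclideanSpace ℝ (Fin n)) where
  /-- The end time. -/
  time : ℝ
  /-- The trajectory; its values outside `[0, time]` are irrelevant. -/
  curve : ℝ → EuclideanSpace ℝ (Fin n)
  le_time : T ≤ time
  isTrajectoryOn : IsTrajectoryOn X F (Icc 0 time) curve
  eqOn : EqOn curve x (Icc 0 T)

/-- The relation "`b` extends `a`" on continuations. It is only a preorder, as values outside the
time interval are disregarded. -/
def Continuation.ExtendedBy {T : ℝ} {x : ℝ → EuclideanSpace ℝ (Fin n)}
    (a b : Continuation X F T x) : Prop :=
  a.time ≤ b.time ∧ EqOn b.curve a.curve (Icc 0 a.time)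

theorem Continuation.ExtendedBy.trans {T : ℝ} {x : ℝ → EuclideanSpace ℝ (Fin n)}
    {a b c : Continuation X F T x} (hab : a.ExtendedBy b) (hbc : b.ExtendedBy c) :
    a.ExtendedBy c :=
  ⟨hab.1.trans hbc.1, fun _ ht => (hbc.2 ⟨ht.1, ht.2.trans hab.1⟩).trans (hab.2 ht)⟩

/-- A chain of continuations either fits together to a complete trajectory or has an upper bound. -/
theorem Continuation.exists_complete_or_upperBound (hX : IsCompact X) (hF : ContinuousOn F X)
    {T : ℝ} (hT : 0 ≤ T) {x : ℝ → EuclideanSpace ℝ (Fin n)}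
    (hx : IsTrajectoryOn X F (Icc 0 T) x) {c : Set (Continuation X F T x)}
    (hc : IsChain Continuation.ExtendedBy c) :
    (∃ y, IsTrajectoryOn X F (Ici 0) y ∧ EqOn y x (Icc 0 T)) ∨
      ∃ ub : Continuation X F T x, ∀ a ∈ c, a.ExtendedBy ub := by
  classical
  rcases c.eq_empty_or_nonempty with rfl | ⟨a₀, ha₀⟩
  · exact Or.inr ⟨⟨T, x, le_rfl, hx, fun _ _ => rfl⟩, by simp⟩
  have hcmp : ∀ a ∈ c, ∀ b ∈ c, a.ExtendedBy b ∨ b.ExtendedBy a := fun a ha b hb => by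
    by_cases hab : a = b
    · exact Or.inl (hab ▸ ⟨le_rfl, fun _ _ => rfl⟩)
    · exact hc ha hb hab
  have hagree : ∀ a ∈ c, ∀ b ∈ c, ∀ t, 0 ≤ t → t ≤ a.time → t ≤ b.time →
      a.curve t = b.curve t := fun a ha b hb t h0 hta htb => by
    rcases hcmp a ha b hb with h | h
    · exact (h.2 ⟨h0, hta⟩).symm
    · exact h.2 ⟨h0, htb⟩
  by_cases hmax : ∃ a ∈ c, ∀ b ∈ c, b.time ≤ a.time
  · obtain ⟨a, ha, hle⟩ := hmax
    exact Or.inr ⟨a, fun b hb => ⟨hle b hb, fun t ht =>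
      hagree a ha b hb t ht.1 (ht.2.trans (hle b hb)) ht.2⟩⟩
  push Not at hmax
  -- `y` is the union of the chain.
  set y : ℝ → EuclideanSpace ℝ (Fin n) := fun t =>
    if h : ∃ a ∈ c, t ≤ a.time then h.choose.curve t else 0 with hy_def
  have hyeq : ∀ a ∈ c, EqOn y a.curve (Icc 0 a.time) := fun a ha t ht => by
    have h : ∃ a ∈ c, t ≤ a.time := ⟨a, ha, ht.2⟩
    simp only [hy_def, dif_pos h]
    exact hagree _ h.choose_spec.1 a ha t ht.1 h.choose_spec.2 ht.2
  have hyt : ∀ a ∈ c, IsTrajectoryOn X F (Icc 0 a.time) y := fun a ha =>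
    a.isTrajectoryOn.congr (hyeq a ha)
  have hyx : EqOn y x (Icc 0 T) := fun t ht =>
    (hyeq a₀ ha₀ ⟨ht.1, ht.2.trans a₀.le_time⟩).trans (a₀.eqOn ht)
  by_cases hbdd : BddAbove (Continuation.time '' c)
  · right
    set S := sSup (Continuation.time '' c)
    have hlt : ∀ a ∈ c, a.time < S := fun a ha => by
      obtain ⟨b, hb, hab⟩ := hmax a ha
      exact hab.trans_le (le_csSup hbdd ⟨b, hb, rfl⟩)
    have hTS : T < S := a₀.le_time.trans_lt (hlt a₀ ha₀)
    have hIco : IsTrajectoryOn X F (Ico 0 S) y := by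
      refine isTrajectoryOn_of_forall_Icc Ico_subset_Ici_self fun t ht => ?_
      obtain ⟨_, ⟨a, ha, rfl⟩, hta⟩ := exists_lt_of_lt_csSup
        (Set.Nonempty.image Continuation.time ⟨a₀, ha₀⟩) ht.2
      exact ⟨a.time, hta, hyt a ha⟩
    obtain ⟨z, hz, hzy⟩ := hIco.exists_extend_Icc hX hF (hT.trans_lt hTS)
    exact ⟨⟨S, z, hTS.le, hz, fun t ht => (hzy ⟨ht.1, ht.2.trans_lt hTS⟩).trans (hyx ht)⟩,
      fun a ha => ⟨(hlt a ha).le, fun t ht =>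
        (hzy ⟨ht.1, ht.2.trans_lt (hlt a ha)⟩).trans (hyeq a ha ht)⟩⟩
  · left
    refine ⟨y, isTrajectoryOn_of_forall_Icc subset_rfl fun t _ => ?_, hyx⟩
    obtain ⟨_, ⟨a, ha, rfl⟩, hta⟩ := not_bddAbove_iff.1 hbdd t
    exact ⟨a.time, hta, hyt a ha⟩

theorem isForwardCompleteNear_of_isLyapunovStable (hX : IsCompact X) (hF : ContinuousOn F X)
    (hstab : IsLyapunovStable X F E) (hsol : IsLocallySolvableNear X F E) :
    IsForwardCompleteNear X F E := by
  obtain ⟨ρ, hρ, hsol⟩ := hsol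
  obtain ⟨r, hr, hstab⟩ := hstab ρ hρ
  refine ⟨r, hr, fun T hT x hx hx0 => ?_⟩
  by_contra hcon
  obtain ⟨a, ha⟩ := exists_maximal_of_chains_bounded
    (r := Continuation.ExtendedBy (X := X) (F := F) (T := T) (x := x))
    (fun c hc => (Continuation.exists_complete_or_upperBound hX hF hT hx hc).resolve_left hcon)
    Continuation.ExtendedBy.trans
  have hS : 0 ≤ a.time := hT.trans a.le_time
  have hend : a.time ∈ Icc 0 a.time := ⟨hS, le_rfl⟩
  have h0 : a.curve 0 = x 0 := a.eqOn ⟨le_rfl, hT⟩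
  have hnear : a.curve a.time ∈ thickening ρ E :=
    hstab a.time hS a.curve a.isTrajectoryOn (by rwa [h0]) _ hend
  obtain ⟨τ, hτ, w, hw, hw0⟩ := hsol _ ⟨a.isTrajectoryOn.2 hend, hnear⟩
  obtain ⟨y, hy, hya⟩ := a.isTrajectoryOn.exists_concat hS hw hw0
  have hle : a.time ≤ a.time + τ := by linarith
  let b : Continuation X F T x := ⟨a.time + τ, y, a.le_time.trans hle, hy, fun t ht =>
    (hya ⟨ht.1, ht.2.trans a.le_time⟩).trans (a.eqOn ht)⟩
  have h : a.time + τ ≤ a.time := (ha b ⟨hle, hya⟩).1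
  linarith

end Continuation

end ClosedLoop

theorem mainTheorem6 {n m p : ℕ}
    (f : EuclideanSpace ℝ (Fin n) → EuclideanSpace ℝ (Fin n))
    (g : EuclideanSpace ℝ (Fin n) → EuclideanSpace ℝ (Fin m) →L[ℝ] EuclideanSpace ℝ (Fin n))
    (hf : LocallyLipschitz f) (hg : LocallyLipschitz g)
    (X : Set (EuclideanSpace ℝ (Fin n))) (hX : IsCompact X)
    (φ : EuclideanSpace ℝ (Fin n) → EuclideanSpace ℝ (Fin p)) (q : EuclideanSpace ℝ (Fin p))
    (V : EuclideanSpace ℝ (Fin n) → ℝ) (hV : ∀ x ∈ X, ContDiffAt ℝ 1 V x)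
    (hVpos : ∀ x ∈ X, x ∉ ClosedLoop.goalSet X φ q → 0 < V x)
    (hVzero : ∀ x ∈ ClosedLoop.goalSet X φ q, V x = 0)
    (u : EuclideanSpace ℝ (Fin n) → EuclideanSpace ℝ (Fin m)) (hu : ContinuousOn u X)
    (hdecr : ∀ x ∈ X, x ∉ ClosedLoop.goalSet X φ q →
      ClosedLoop.lieDeriv (ClosedLoop.field f g u) V x < 0)
    (hrest : ∀ x ∈ ClosedLoop.goalSet X φ q, f x + g x (u x) = 0) :
    ClosedLoop.IsAsymptoticallyStable X (ClosedLoop.field f g u) (ClosedLoop.goalSet X φ q) ∧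
      (ClosedLoop.IsLocallySolvableNear X (ClosedLoop.field f g u) (ClosedLoop.goalSet X φ q) →
        ClosedLoop.IsForwardCompleteNear X (ClosedLoop.field f g u)
          (ClosedLoop.goalSet X φ q)) := by

  have hEX : ClosedLoop.goalSet X φ q ⊆ X := fun x hx => hx.1
  have hF : ContinuousOn (ClosedLoop.field f g u) X :=
    hf.continuous.continuousOn.add (hg.continuous.continuousOn.clm_apply hu)
  have hd : ∀ x ∈ X, ClosedLoop.lieDeriv (ClosedLoop.field f g u) V x ≤ 0 := fun x hx => by
    by_cases hxE : x ∈ ClosedLoop.goalSet X φ q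
    · have h0 : ClosedLoop.field f g u x = 0 := hrest x hxE
      rw [ClosedLoop.lieDeriv, h0, inner_zero_right]
    · exact (hdecr x hx hxE).le
  have hstab := ClosedLoop.isLyapunovStable_of_lieDeriv_nonpos hX hEX hV hVpos hVzero hd
  exact ⟨⟨hstab,
      ClosedLoop.isAttractive_of_lieDeriv_neg hX hEX hF hV hVpos hVzero hd hdecr⟩,
    ClosedLoop.isForwardCompleteNear_of_isLyapunovStable hX hF hstab⟩
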